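/- Let $n\ge 1$, $r\ge 2$ and $s\ge 0$ be integers, let $\mathcal P=\{P_1,\dots,P_l\}$ be a partition of $[n]=\{1,\dots,n\}$ with $|P_i|\le r$ for all $i$, and let $\mathcal F$ be a family of subsets of $[n]$ with $|F|>s$ for all $F\in\mathcal F$. A set $A\subseteq[n]$ is called $\mathcal P$-admissible if $|A\cap P_i|\le 1$ for all $i$. For an integer $q\ge 0$ and $A,B\subseteq [n]$, write $A\subseteq_q B$ if there is a set $E$ with $|E|\le q$ and $A\setminus E\subseteq B$. Let $\mathrm{KG}^r(\mathcal F,\mathcal P,s)$ be the $r$-uniform hypergraph whose vertices are the $\mathcal P$-admissible members of $\mathcal F$ and whose edges are the $r$-element sets $\{F_1,\dots,F_r\}$ of vertices with $|F_i\cap F_j|\le s$ for all $1\le i<j\le r$. Its chromatic number $\chi$ is the least number of colors in a coloring of the vertices without monochromatic edges. Let $\mathrm{ecd}^r(\mathcal F,q)$ be the minimum size of a set $X_0\subseteq[n]$ for which $[n]\setminus X_0$ can be partitioned into $r$ (possibly empty) sets $X_1,\dots,X_r$ such that $\big||X_i|-|X_j|\big|\le 1$ for all $i,j$ and such that $F\subseteq_q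 X_i$ holds for no $F\in\mathcal F$ and no $i$. Suppose that the pair $(\mathcal F,\mathcal P)$ is $\lfloor s/2\rfloor$-good, that is, for every $\mathcal P$-admissible set $A\subseteq[n]$ for which some $F\in\mathcal F$ satisfies $F\subseteq_{\lfloor s/2\rfloor}A$, there is a $\mathcal P$-admissible $F'\in\mathcal F$ with $F'\subseteq_{\lfloor s/2\rfloor}A$. Then $$\chi\big(\mathrm{KG}^r(\mathcal F,\mathcal P,s)\big)\ \ge\ \left\lceil\frac{\mathrm{ecd}^r(\mathcal F,\lfloor s/2\rfloor)}{r-1}\right\rceil .$$ -/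

import Mathlib

namespace KneserType

section Hypergraphs

variable {V : Type*}

/-- `H` is `k`-colorable: the vertices can be coloured with `k` colours in such a way that no edge
is monochromatic. -/
def Colorable (H : Hypergraph V) (k : ℕ) : Prop :=
  ∃ c : H.vertexSet → Fin k,
    ∀ e ∈ H.edgeSet, ∃ x y : H.vertexSet, (x : V) ∈ e ∧ (y : V) ∈ e ∧ c x ≠ c y

/-- The chromatic number of a hypergraph: the least `k` such that the hypergraph is `k`-colorable
(and `⊤` if there is none, for instance if some edge is a loop). -/
noncomputable def chromaticNumber (H : Hypergraph V) : ℕ∞ :=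
  ⨅ k ∈ {k : ℕ | Colorable H k}, (k : ℕ∞)

end Hypergraphs

section SetSystems

variable {α : Type*} [DecidableEq α]

/-- The members of the finite family `P` are pairwise disjoint and their union is `X`
(empty members are allowed). -/
def IsPartitionOf {ι : Type*} [Fintype ι] (P : ι → Finset α) (X : Finset α) : Prop :=
  (∀ i j, i ≠ j → Disjoint (P i) (P j)) ∧ Finset.univ.biUnion P = X

/-- `A` is `P`-admissible: it has at most one element in each part of `P`. -/
def Admissible {ι : Type*} (P : ι → Finset α) (A : Finset α) : Prop :=
  ∀ i, (A ∩ P i).card ≤ 1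

/-- `A ⊆_s B`: some set `E` of size at most `s` satisfies `A \ E ⊆ B`. -/
def SubsetUpTo (s : ℕ) (A B : Finset α) : Prop :=
  ∃ E : Finset α, E.card ≤ s ∧ A \ E ⊆ B

/-- The pair `(𝓕, P)` is `s`-good: whenever `F ⊆_s A` for some `F ∈ 𝓕` and some `P`-admissible
set `A`, there is a `P`-admissible `F' ∈ 𝓕` with `F' ⊆_s A`. -/
def Good {ι : Type*} (𝓕 : Set (Finset α)) (P : ι → Finset α) (s : ℕ) : Prop :=
  ∀ A : Finset α, Admissible P A → (∃ F ∈ 𝓕, SubsetUpTo s F A) →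
    ∃ F' ∈ 𝓕, Admissible P F' ∧ SubsetUpTo s F' A

/-- The hypergraph `KG^r(𝓕, P, s)`: its vertices are the `P`-admissible members of `𝓕`, its edges
the `r`-element sets of vertices that pairwise intersect in at most `s` elements. -/
def KG {ι : Type*} (r : ℕ) (𝓕 : Set (Finset α)) (P : ι → Finset α) (s : ℕ) :
    Hypergraph (Finset α) where
  vertexSet := {A | A ∈ 𝓕 ∧ Admissible P A}
  edgeSet := {e | e ⊆ {A | A ∈ 𝓕 ∧ Admissible P A} ∧ e.ncard = r ∧
    ∀ A ∈ e, ∀ B ∈ e, A ≠ B → (A ∩ B).card ≤ s}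
  subset_vertexSet_of_mem_edgeSet' := fun _ he => he.1

/-- `X` is an equitable partition of `Y` into `r` (possibly empty) parts: the sizes of any two
parts differ by at most one. -/
def IsEquitablePartitionOf {r : ℕ} (X : Fin r → Finset α) (Y : Finset α) : Prop :=
  IsPartitionOf X Y ∧ ∀ i j, (X i).card ≤ (X j).card + 1

/-- `X₀` is a set whose complement has an equitable partition `X₁, …, X_r` such that `F ⊆_s X_i`
holds for no `F ∈ 𝓕` and no `i`. -/
def IsDefectSet [Fintype α] (r : ℕ) (𝓕 : Set (Finset α)) (s : ℕ) (X₀ : Finset α) : Prop :=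
  ∃ X : Fin r → Finset α, IsEquitablePartitionOf X (Finset.univ \ X₀) ∧
    ∀ F ∈ 𝓕, ∀ i, ¬ SubsetUpTo s F (X i)

/-- The general equitable `r`-colorability defect `ecd^r(𝓕, s)`: the minimum size of a set `X₀` as
in `IsDefectSet`. -/
noncomputable def ecd [Fintype α] (r : ℕ) (𝓕 : Set (Finset α)) (s : ℕ) : ℕ :=
  sInf {m | ∃ X₀ : Finset α, X₀.card = m ∧ IsDefectSet r 𝓕 s X₀}

/-- The minimum that defines `ecd` is over a nonempty set when all members of `𝓕` have more than
`s` elements. -/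
theorem isDefectSet_univ [Fintype α] (r : ℕ) (𝓕 : Set (Finset α)) (s : ℕ)
    (h : ∀ F ∈ 𝓕, s < F.card) : IsDefectSet r 𝓕 s Finset.univ := by
  refine ⟨fun _ => ∅, ⟨⟨by simp, by ext; simp⟩, by simp⟩, ?_⟩
  rintro F hF i ⟨E, hE, hFE⟩
  have h1 : F ⊆ E := by simpa using hFE
  have h2 := Finset.card_le_card h1
  have h3 := h F hF
  omega

end SetSystems

end KneserType

/-!
The colouring of the hypergraph is transported to admissible sets: `A` gets the colours of the
vertices `F` with `F ⊆_{s / 2} A`. A colour shared by `r` disjoint admissible sets gives a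
monochromatic edge, so it suffices to show (`hasUncoloredFamilies`): if no colour among `t` is
shared by `r` disjoint admissible sets, there are `r` disjoint admissible uncoloured sets of nearly
equal sizes that miss at most `t (r - 1)` points. By goodness such sets witness the bound on the
defect.

For a prime `r = p` (`exists_transversalFamily_zmod`), an `r`-tuple of disjoint sets is a sign vector
with signs in `ℤ/p`. If the statement failed, the sign vectors on `N` points would have a monotone
rank with values in `{1, …, N - 1}`: uncoloured ones are ranked by the largest size of a balanced
admissible family in their classes, coloured ones by how many signs each colour occupies. On chains
of constant rank, some nonempty proper subset of `ℤ/p` attached to the sign vector is constant, and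
its mean is an equivariant label that is constant too. A chain of `N` sign vectors with different
consecutive labels would then have strictly increasing ranks, which is absurd. Such a chain exists
for every equivariant labelling (`exists_alternating_chain`, a cyclic form of Fan's lemma).

Fan's lemma is proved algebraically. Sign vectors on an initial segment of the points can be coned
off inside the next segment, which gives chains `z_k` whose boundaries are alternately
`(g - 1) z_{k - 1}` and the norm of `z_{k - 1}`. A labelling maps them to the periodic resolution of
the cyclic group, where the augmentation modulo `p` is the same in all degrees, hence nonzero, whereas
lists with two equal consecutive labels go to zero.

Products of primes are reached by `HasUncoloredFamilies.mul`, where each part of the partition is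
split further so that the statement applies to both factors.
-/

open Finset

namespace KneserType

/-! ### The periodic resolution of a cyclic group -/

section Resolution

variable {m : ℕ}

/-- The group ring of `ℤ/(m+1)` over `ZMod (m + 1)`, as functions on `Fin (m + 1)`. The coefficients are
chosen so that the sum of a constant function vanishes. -/
abbrev Coeff (m : ℕ) : Type := Fin (m + 1) → ZMod (m + 1)

/-- The two-periodic complex of the cyclic group of order `m + 1`, folded modulo `2`: the first
component collects the even degrees, the second one the odd degrees, where the degree of a list is
its length. Folding spares all bookkeeping of degrees. -/
abbrev Periodic (m : ℕ) : Type := Coeff m × Coeff m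

/-- The action of the cyclic group on the periodic complex. -/
def translate (a : Fin (m + 1)) : Periodic m →ₗ[ZMod (m + 1)] Periodic m where
  toFun w := (fun x => w.1 (x - a), fun x => w.2 (x - a))
  map_add' _ _ := rfl
  map_smul' _ _ := rfl

/-- The differential: the norm from odd to even degrees, `g - 1` from even to odd degrees. -/
def periodicD : Periodic m →ₗ[ZMod (m + 1)] Periodic m where
  toFun w := (fun _ => ∑ x, w.2 x, fun x => w.1 (x - 1) - w.1 x)
  map_add' v w := by
    ext x
    · simp [Finset.sum_add_distrib]
    · simp; ring
  map_smul' c w := by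
    ext x
    · simp [Finset.mul_sum]
    · simp; ring

/-- A contracting homotopy of the periodic complex (not equivariant) with square zero. From odd to
even degrees it sends `g ^ j` to `1 + g + ⋯ + g ^ (j - 1)`, from even to odd degrees it picks the
coefficient of `g ^ m`. -/
def contraction : Periodic m →ₗ[ZMod (m + 1)] Periodic m where
  toFun w := (fun x => ∑ j ∈ Ioi x, w.2 j, fun x => if x = 0 then w.1 (Fin.last m) else 0)
  map_add' v w := by
    ext x
    · simp [Finset.sum_add_distrib]
    · simp; split_ifs <;> simp
  map_smul' c w := by
    ext x
    · simp [Finset.mul_sum]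
    · simp

theorem Ioi_last_eq_empty : Ioi (Fin.last m) = ∅ := by
  ext j; simp [Fin.le_last]

theorem sum_Ioi_castSucc (f : Fin (m + 1) → ZMod (m + 1)) (x : Fin m) :
    ∑ j ∈ Ioi x.castSucc, f j = f x.succ + ∑ j ∈ Ioi x.succ, f j := by
  have h : Ioi x.castSucc = insert x.succ (Ioi x.succ) := by
    ext j
    simp only [mem_Ioi, mem_insert, Fin.lt_def, Fin.ext_iff, Fin.val_succ, Fin.val_castSucc]
    omega
  rw [h, Finset.sum_insert (by simp)]

theorem succ_sub_one (x : Fin m) : x.succ - 1 = x.castSucc := by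
  rw [sub_eq_iff_eq_add]; simp

theorem zero_sub_one_eq_last : (0 : Fin (m + 1)) - 1 = Fin.last m := by
  rw [sub_eq_iff_eq_add]; simp

theorem sum_Ioi_telescope (f : Fin (m + 1) → ZMod (m + 1)) (x : Fin (m + 1)) :
    ∑ j ∈ Ioi x, (f (j - 1) - f j) = f x - f (Fin.last m) := by
  induction x using Fin.reverseInduction with
  | last =>
    simp [Ioi_last_eq_empty]
  | cast x ih => rw [sum_Ioi_castSucc, ih, succ_sub_one]; ring

theorem periodicD_contraction (w : Periodic m) :
    periodicD (contraction w) + contraction (periodicD w) = w := by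
  ext x
  · simp [periodicD, contraction]
    rw [← Finset.sum_sub_distrib, sum_Ioi_telescope]
    ring
  · simp only [periodicD, contraction, LinearMap.coe_mk, AddHom.coe_mk, Prod.snd_add, Pi.add_apply]
    cases x using Fin.cases with
    | zero =>
      have h2 : (univ : Finset (Fin (m + 1))) = insert 0 (Ioi 0) := by
        ext j
        simpa using em (j = 0)
      rw [zero_sub_one_eq_last, Ioi_last_eq_empty, h2, Finset.sum_insert (by simp)]
      simp
    | succ x =>
      rw [succ_sub_one, sum_Ioi_castSucc]
      simp [Fin.succ_ne_zero]

theorem contraction_contraction (w : Periodic m) : contraction (contraction w) = 0 := by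
  ext x
  · simp only [contraction, LinearMap.coe_mk, AddHom.coe_mk]
    refine Finset.sum_eq_zero fun j hj => ?_
    have : j ≠ 0 := by rintro rfl; simp at hj
    simp [this]
  · simp [contraction, Ioi_last_eq_empty]

theorem translate_translate (a b : Fin (m + 1)) (w : Periodic m) :
    translate a (translate b w) = translate (a + b) w := by
  ext x <;> simp [translate, sub_sub]

theorem translate_zero (w : Periodic m) : translate 0 w = w := by
  ext x <;> simp [translate]

theorem periodicD_translate (a : Fin (m + 1)) (w : Periodic m) :
    periodicD (translate a w) = translate a (periodicD w) := by
  ext x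
  · simp only [periodicD, translate, LinearMap.coe_mk, AddHom.coe_mk]
    exact (Equiv.subRight a).sum_comp w.2
  · simp [periodicD, translate, sub_right_comm]

/-- The contracting homotopy based at the group element `a` instead of `0`. -/
def coneAt (a : Fin (m + 1)) : Periodic m →ₗ[ZMod (m + 1)] Periodic m :=
  translate a ∘ₗ contraction ∘ₗ translate (-a)

theorem periodicD_coneAt (a : Fin (m + 1)) (w : Periodic m) :
    periodicD (coneAt a w) = w - coneAt a (periodicD w) := by
  have h := periodicD_contraction (translate (-a) w)
  apply_fun translate a at h
  rw [map_add, translate_translate, add_neg_cancel, translate_zero, periodicD_translate] at h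
  rw [eq_sub_iff_add_eq]
  simpa [coneAt, periodicD_translate] using h

theorem coneAt_coneAt (a : Fin (m + 1)) (w : Periodic m) : coneAt a (coneAt a w) = 0 := by
  simp [coneAt, translate_translate, translate_zero, contraction_contraction]

theorem coneAt_add (a b : Fin (m + 1)) (w : Periodic m) :
    coneAt (a + b) (translate b w) = translate b (coneAt a w) := by
  simp only [coneAt, LinearMap.comp_apply, translate_translate]
  congr 2
  · abel
  · congr 2; abel

/-- The comparison map from the bar complex (lists of group elements) to the periodic complex, defined
by coning. The empty list, in degree `0`, goes to the norm element. -/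
def comparison : List (Fin (m + 1)) → Periodic m
  | [] => (fun _ => 1, fun _ => 0)
  | a :: l => coneAt a (comparison l)

theorem comparison_map_add_one (l : List (Fin (m + 1))) :
    comparison (l.map (· + 1)) = translate 1 (comparison l) := by
  induction l with
  | nil => rfl
  | cons a l ih => simp only [List.map_cons, comparison, ih, coneAt_add]

/-- Since `coneAt a` has square zero, the comparison map kills all lists with two equal consecutive
entries. This is how the final chain is seen to have alternating labels. -/
theorem isChain_of_comparison_ne_zero (l : List (Fin (m + 1))) (h : comparison l ≠ 0) :
    l.IsChain (· ≠ ·) := by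
  induction l with
  | nil => simp
  | cons a l ih =>
    have hl : comparison l ≠ 0 := fun h0 => h (by simp [comparison, h0])
    cases l with
    | nil => simp
    | cons b l =>
      refine List.isChain_cons_cons.2 ⟨?_, ih hl⟩
      rintro rfl
      exact h (coneAt_coneAt _ _)

end Resolution

/-! ### Chains of lists in an ordered set -/

section ListComplex

variable {K : Type*} [CommRing K] {E : Type*}

/-- Prepending a vertex to all lists of a chain. -/
noncomputable def consMap (a : E) : (List E →₀ K) →ₗ[K] (List E →₀ K) :=
  Finsupp.lmapDomain K K (List.cons a)

/-- The chain map induced by a map of vertices. -/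
noncomputable def mapMap {E' : Type*} (f : E → E') : (List E →₀ K) →ₗ[K] (List E' →₀ K) :=
  Finsupp.lmapDomain K K (List.map f)

/-- The simplicial boundary of an ordered simplex, written as a list of vertices. Lists of length `k`
have dimension `k - 1`, and the empty list makes the complex augmented. -/
noncomputable def boundary : List E → (List E →₀ K)
  | [] => 0
  | a :: l => Finsupp.single l 1 - consMap a (boundary l)

/-- The linear extension of `boundary`. -/
noncomputable def boundaryMap : (List E →₀ K) →ₗ[K] (List E →₀ K) :=
  Finsupp.linearCombination K boundary

/-- The prism homotopy between the identity and the chain map induced by `j`. -/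
noncomputable def prism (j : E → E) : List E → (List E →₀ K)
  | [] => 0
  | x :: l => Finsupp.single (x :: j x :: l.map j) 1 - consMap x (prism j l)

/-- The linear extension of `prism`. -/
noncomputable def prismMap (j : E → E) : (List E →₀ K) →ₗ[K] (List E →₀ K) :=
  Finsupp.linearCombination K (prism j)

@[simp] theorem consMap_single (a : E) (l : List E) (c : K) :
    consMap a (Finsupp.single l c) = Finsupp.single (a :: l) c := by
  simp [consMap]

@[simp] theorem mapMap_single {E' : Type*} (f : E → E') (l : List E) (c : K) :
    mapMap f (Finsupp.single l c) = Finsupp.single (l.map f) c := by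
  simp [mapMap]

@[simp] theorem boundaryMap_single (l : List E) (c : K) :
    boundaryMap (Finsupp.single l c) = c • boundary l := by
  simp [boundaryMap]

@[simp] theorem prismMap_single (j : E → E) (l : List E) (c : K) :
    prismMap j (Finsupp.single l c) = c • prism j l := by
  simp [prismMap]

theorem linearMap_ext_single {M : Type*} [AddCommGroup M] [Module K M]
    {f g : (List E →₀ K) →ₗ[K] M}
    (h : ∀ l, f (Finsupp.single l 1) = g (Finsupp.single l 1)) (z : List E →₀ K) : f z = g z := by
  have : f = g := by
    ext l
    simpa using h l
  rw [this]

theorem boundaryMap_consMap (a : E) (z : List E →₀ K) :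
    boundaryMap (consMap a z) = z - consMap a (boundaryMap z) := by
  refine linearMap_ext_single (f := boundaryMap ∘ₗ consMap a)
    (g := LinearMap.id - consMap a ∘ₗ boundaryMap) (fun l => ?_) z
  simp [boundary]

theorem mapMap_consMap {E' : Type*} (f : E → E') (a : E) (z : List E →₀ K) :
    mapMap f (consMap a z) = consMap (f a) (mapMap f z) := by
  refine linearMap_ext_single (f := mapMap f ∘ₗ consMap a)
    (g := consMap (f a) ∘ₗ mapMap f) (fun l => ?_) z
  simp

theorem boundary_map {E' : Type*} (f : E → E') (l : List E) :
    (boundary (l.map f) : List E' →₀ K) = mapMap f (boundary l) := by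
  induction l with
  | nil => simp [boundary]
  | cons a l ih => simp [boundary, ih, mapMap_consMap]

theorem boundaryMap_mapMap {E' : Type*} (f : E → E') (z : List E →₀ K) :
    boundaryMap (mapMap f z) = mapMap f (boundaryMap z) := by
  refine linearMap_ext_single (f := boundaryMap ∘ₗ mapMap f)
    (g := mapMap f ∘ₗ boundaryMap) (fun l => ?_) z
  simp [boundary_map]

theorem prismMap_consMap (j : E → E) (x : E) (z : List E →₀ K) :
    prismMap j (consMap x z) = consMap x (consMap (j x) (mapMap j z)) - consMap x (prismMap j z) := by
  refine linearMap_ext_single (f := prismMap j ∘ₗ consMap x)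
    (g := consMap x ∘ₗ consMap (j x) ∘ₗ mapMap j - consMap x ∘ₗ prismMap j) (fun l => ?_) z
  simp [prism]

theorem boundaryMap_prism (j : E → E) (l : List E) :
    (boundaryMap (prism j l) : List E →₀ K) =
      Finsupp.single (l.map j) 1 - Finsupp.single l 1 - prismMap j (boundary l) := by
  induction l with
  | nil => simp [prism, boundary]
  | cons x l ih =>
    simp only [prism, map_sub, boundaryMap_consMap, ih, boundary, boundaryMap_single, one_smul,
      List.map_cons, prismMap_single, prismMap_consMap, consMap_single, boundary_map]
    abel

theorem boundaryMap_prismMap (j : E → E) (z : List E →₀ K) :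
    boundaryMap (prismMap j z) = mapMap j z - z - prismMap j (boundaryMap z) := by
  refine linearMap_ext_single (f := boundaryMap ∘ₗ prismMap j)
    (g := mapMap j - LinearMap.id - prismMap j ∘ₗ boundaryMap) (fun l => ?_) z
  simp [boundaryMap_prism]

/-- A cone with apex `e` that first moves a cycle along `j` and then joins it to `e`. It is made for the
situation `x ≤ j x ≥ e`, in which `e` need not be comparable with `x`. -/
noncomputable def coneMap (e : E) (j : E → E) : (List E →₀ K) →ₗ[K] (List E →₀ K) :=
  consMap e ∘ₗ mapMap j - prismMap j

theorem boundaryMap_coneMap (e : E) (j : E → E) {z : List E →₀ K} (hz : boundaryMap z = 0) :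
    boundaryMap (coneMap e j z) = z := by
  simp [coneMap, boundaryMap_consMap, boundaryMap_mapMap, boundaryMap_prismMap, hz]

theorem map_mem_of_forall_mem_supported {A : Set (List E)} {M : Type*} [AddCommGroup M] [Module K M]
    {N : Submodule K M} (f : (List E →₀ K) →ₗ[K] M) (hf : ∀ l ∈ A, f (Finsupp.single l 1) ∈ N)
    {z : List E →₀ K} (hz : z ∈ Finsupp.supported K K A) : f z ∈ N := by
  rw [Finsupp.supported_eq_span_single] at hz
  have : Submodule.span K ((fun i => Finsupp.single i (1 : K)) '' A) ≤ N.comap f := by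
    rw [Submodule.span_le]
    rintro _ ⟨l, hl, rfl⟩
    exact hf l hl
  exact this hz

variable [Preorder E]

variable (K) in
/-- The chains spanned by weakly increasing lists of length `k` with entries in `S`. -/
noncomputable def orderChains (S : Set E) (k : ℕ) : Submodule K (List E →₀ K) :=
  Finsupp.supported K K {l | l.length = k ∧ l.Pairwise (· ≤ ·) ∧ ∀ x ∈ l, x ∈ S}

theorem mapMap_mem_orderChains {f : E → E} {S S' : Set E} (hf : MonotoneOn f S)
    (hS : Set.MapsTo f S S') {k : ℕ} {z : List E →₀ K} (hz : z ∈ orderChains K S k) :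
    mapMap f z ∈ orderChains K S' k := by
  refine map_mem_of_forall_mem_supported (mapMap f) (fun l hl => ?_) hz
  obtain ⟨h1, h2, h3⟩ := hl
  rw [mapMap_single]
  refine Finsupp.single_mem_supported K _ ⟨by simpa using h1, ?_, ?_⟩
  · rw [List.pairwise_map]
    exact h2.imp_of_mem fun ha hb hab => hf (h3 _ ha) (h3 _ hb) hab
  · intro x hx
    obtain ⟨y, hy, rfl⟩ := List.mem_map.1 hx
    exact hS (h3 y hy)

/-- The entries of the lists in `prism j l` are recorded in terms of `l`, because the induction needs to
prepend a lower bound of `l`. -/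
theorem prism_mem_supported {j : E → E} {S : Set E} (hj : MonotoneOn j S) (hle : ∀ x ∈ S, x ≤ j x)
    (l : List E) (hl : l.Pairwise (· ≤ ·)) (hlS : ∀ x ∈ l, x ∈ S) :
    (prism j l : List E →₀ K) ∈ Finsupp.supported K K
      {l' | l'.length = l.length + 1 ∧ l'.Pairwise (· ≤ ·) ∧
        ∀ z ∈ l', ∃ y ∈ l, z = y ∨ z = j y} := by
  induction l with
  | nil => simp [prism]
  | cons x l ih =>
    rw [List.pairwise_cons] at hl
    have hx := hlS x (by simp)
    have hl' : ∀ y ∈ l, y ∈ S := fun y hy => hlS y (by simp [hy])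
    refine Submodule.sub_mem _ (Finsupp.single_mem_supported K _ ⟨by simp, ?_, ?_⟩) ?_
    · simp only [List.pairwise_cons, List.mem_cons, List.mem_map, List.pairwise_map]
      refine ⟨?_, ?_, hl.2.imp_of_mem fun ha hb hab => hj (hl' _ ha) (hl' _ hb) hab⟩
      · rintro _ (rfl | ⟨y, hy, rfl⟩)
        · exact hle x hx
        · exact (hl.1 y hy).trans (hle y (hl' y hy))
      · rintro _ ⟨y, hy, rfl⟩
        exact hj hx (hl' y hy) (hl.1 y hy)
    · simp only [List.mem_cons, List.mem_map]
      rintro z (rfl | rfl | ⟨y, hy, rfl⟩)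
      · exact ⟨z, by simp⟩
      · exact ⟨x, by simp⟩
      · exact ⟨y, by simp [hy]⟩
    · refine map_mem_of_forall_mem_supported (consMap x) (fun l' h' => ?_) (ih hl.2 hl')
      obtain ⟨h1, h2, h3⟩ := h'
      rw [consMap_single]
      refine Finsupp.single_mem_supported K _ ⟨by simp [h1], ?_, ?_⟩
      · refine List.pairwise_cons.2 ⟨fun z hz => ?_, h2⟩
        obtain ⟨y, hy, rfl | rfl⟩ := h3 z hz
        · exact hl.1 z hy
        · exact (hl.1 y hy).trans (hle y (hl' y hy))
      · intro z hz
        rcases List.mem_cons.1 hz with rfl | hz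
        · exact ⟨z, by simp⟩
        · obtain ⟨y, hy, h⟩ := h3 z hz
          exact ⟨y, by simp [hy], h⟩

theorem coneMap_mem_orderChains {e : E} {j : E → E} {S S' : Set E} (hSS' : S ⊆ S') (he : e ∈ S')
    (hj : MonotoneOn j S) (hjS : Set.MapsTo j S S') (hle : ∀ x ∈ S, x ≤ j x ∧ e ≤ j x) {k : ℕ}
    {z : List E →₀ K} (hz : z ∈ orderChains K S k) :
    coneMap e j z ∈ orderChains K S' (k + 1) := by
  refine Submodule.sub_mem _ ?_ ?_
  · refine map_mem_of_forall_mem_supported (consMap e ∘ₗ mapMap j) (fun l hl => ?_) hz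
    obtain ⟨h1, h2, h3⟩ := hl
    rw [LinearMap.comp_apply, mapMap_single, consMap_single]
    refine Finsupp.single_mem_supported K _ ⟨by simp [h1], ?_, ?_⟩
    · simp only [List.pairwise_cons, List.mem_map, List.pairwise_map]
      refine ⟨?_, h2.imp_of_mem fun ha hb hab => hj (h3 _ ha) (h3 _ hb) hab⟩
      rintro _ ⟨y, hy, rfl⟩
      exact (hle y (h3 y hy)).2
    · simp only [List.mem_cons, List.mem_map]
      rintro x (rfl | ⟨y, hy, rfl⟩)
      · exact he
      · exact hjS (h3 y hy)
  · refine map_mem_of_forall_mem_supported (prismMap j) (fun l hl => ?_) hz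
    obtain ⟨h1, h2, h3⟩ := hl
    rw [prismMap_single, one_smul]
    refine Finsupp.supported_mono ?_ (prism_mem_supported hj (fun x hx => (hle x hx).1) l h2 h3)
    rintro l' ⟨h1', h2', h3'⟩
    refine ⟨by omega, h2', fun z hz => ?_⟩
    obtain ⟨y, hy, rfl | rfl⟩ := h3' z hz
    · exact hSS' (h3 z hy)
    · exact hjS (h3 y hy)

end ListComplex

/-! ### Fan's lemma for cyclic groups -/

section EquivariantLabelling

variable {m : ℕ} {E : Type*}

/-- The chain map to the periodic complex given by a labelling `s` of the vertices. -/
noncomputable def labelMap (s : E → Fin (m + 1)) :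
    (List E →₀ ZMod (m + 1)) →ₗ[ZMod (m + 1)] Periodic m :=
  Finsupp.linearCombination _ fun l => comparison (l.map s)

@[simp] theorem labelMap_single (s : E → Fin (m + 1)) (l : List E) (c : ZMod (m + 1)) :
    labelMap s (Finsupp.single l c) = c • comparison (l.map s) := by
  simp [labelMap]

theorem labelMap_consMap (s : E → Fin (m + 1)) (a : E) (z : List E →₀ ZMod (m + 1)) :
    labelMap s (consMap a z) = coneAt (s a) (labelMap s z) := by
  refine linearMap_ext_single (f := labelMap s ∘ₗ consMap a)
    (g := coneAt (s a) ∘ₗ labelMap s) (fun l => ?_) z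
  simp [comparison]

theorem periodicD_comparison (s : E → Fin (m + 1)) (l : List E) :
    periodicD (comparison (l.map s)) = labelMap s (boundary l) := by
  induction l with
  | nil => ext x <;> simp [comparison, boundary, periodicD]
  | cons a l ih =>
    simp [comparison, boundary, periodicD_coneAt, ih, labelMap_consMap]

theorem periodicD_labelMap (s : E → Fin (m + 1)) (z : List E →₀ ZMod (m + 1)) :
    periodicD (labelMap s z) = labelMap s (boundaryMap z) := by
  refine linearMap_ext_single (f := periodicD ∘ₗ labelMap s)
    (g := labelMap s ∘ₗ boundaryMap) (fun l => ?_) z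
  simp [periodicD_comparison]

theorem labelMap_mapMap {s : E → Fin (m + 1)} {g : E → E} (hs : ∀ x, s (g x) = s x + 1)
    (z : List E →₀ ZMod (m + 1)) : labelMap s (mapMap g z) = translate 1 (labelMap s z) := by
  refine linearMap_ext_single (f := labelMap s ∘ₗ mapMap g)
    (g := translate 1 ∘ₗ labelMap s) (fun l => ?_) z
  simp [← comparison_map_add_one, Function.comp_def, hs]

variable (m) in
/-- The operators that attach the `k + 1`-st chain of the periodic sequence to the `k`-th one: the
identity for `k = 0`, then alternately `g - 1` and the norm. -/
noncomputable def periodicTheta (g : E → E) (k : ℕ) :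
    Module.End (ZMod (m + 1)) (List E →₀ ZMod (m + 1)) :=
  if k = 0 then 1 else if Odd k then mapMap g - 1 else ∑ i ∈ range (m + 1), (mapMap g) ^ i

theorem mapMap_pow (g : E → E) (i : ℕ) :
    (mapMap g : Module.End (ZMod (m + 1)) (List E →₀ ZMod (m + 1))) ^ i = mapMap g^[i] := by
  induction i with
  | zero => exact LinearMap.ext (linearMap_ext_single fun l => by simp)
  | succ i ih => exact LinearMap.ext (linearMap_ext_single fun l => by simp [pow_succ, ih])

theorem periodicTheta_mul {g : E → E} (hg : g^[m + 1] = id) {k : ℕ} (hk : k ≠ 0) :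
    periodicTheta m g (k + 1) * periodicTheta m g k = 0 := by
  have h1 : (mapMap g : Module.End (ZMod (m + 1)) (List E →₀ ZMod (m + 1))) ^ (m + 1) = 1 := by
    rw [mapMap_pow, hg]
    exact LinearMap.ext (linearMap_ext_single fun l => by simp)
  rcases Nat.even_or_odd k with h | h
  · have h' : Odd (k + 1) := h.add_one
    rw [periodicTheta, periodicTheta, if_neg (by omega), if_pos h', if_neg hk,
      if_neg (by simpa using h)]
    exact (mul_geom_sum (R := Module.End (ZMod (m + 1)) (List E →₀ ZMod (m + 1)))
      (mapMap g) (m + 1)).trans (sub_eq_zero.2 h1)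
  · have h' : ¬ Odd (k + 1) := by simpa using h.add_one
    rw [periodicTheta, periodicTheta, if_neg (by omega), if_neg h', if_neg hk, if_pos h]
    exact (geom_sum_mul (R := Module.End (ZMod (m + 1)) (List E →₀ ZMod (m + 1)))
      (mapMap g) (m + 1)).trans (sub_eq_zero.2 h1)

theorem labelMap_geom_sum {s : E → Fin (m + 1)} {g : E → E} (hs : ∀ x, s (g x) = s x + 1)
    (z : List E →₀ ZMod (m + 1)) :
    labelMap s ((∑ i ∈ range (m + 1), (mapMap g) ^ i : Module.End _ _) z) =
      (fun _ => ∑ x, (labelMap s z).1 x, fun _ => ∑ x, (labelMap s z).2 x) := by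
  have h : ∀ i : ℕ, labelMap s (((mapMap g) ^ i : Module.End _ _) z) =
      translate (Fin.ofNat (m + 1) i) (labelMap s z) := by
    intro i
    induction i with
    | zero => exact (translate_zero _).symm
    | succ i ih =>
      rw [pow_succ', Module.End.mul_apply, labelMap_mapMap hs, ih, translate_translate]
      congr 2
      ext
      simp [Fin.val_add, add_comm]
  rw [LinearMap.sum_apply, map_sum, Finset.sum_congr rfl fun i _ => h i, Finset.sum_range]
  ext x
  · simp only [Prod.fst_sum, Finset.sum_apply, translate, LinearMap.coe_mk, AddHom.coe_mk,
      Fin.ofNat_val_eq_self]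
    exact (Equiv.subLeft x).sum_comp (labelMap s z).1
  · simp only [Prod.snd_sum, Finset.sum_apply, translate, LinearMap.coe_mk, AddHom.coe_mk,
      Fin.ofNat_val_eq_self]
    exact (Equiv.subLeft x).sum_comp (labelMap s z).2

/-- The difference of the two functions is invariant under translation, hence constant, and the sum of
a constant function over `Fin (m + 1)` is zero in `ZMod (m + 1)`. -/
theorem sum_eq_sum_of_sub_eq_sub {f f' : Coeff m}
    (h : ∀ x, f (x - 1) - f x = f' (x - 1) - f' x) : ∑ x, f x = ∑ x, f' x := by
  have h1 : ∀ x : Fin (m + 1), f x - f' x = f 0 - f' 0 := by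
    intro x
    induction x using Fin.induction with
    | zero => rfl
    | succ x ih =>
      have := h x.succ
      rw [succ_sub_one] at this
      rw [← ih]
      linear_combination -this
  have h2 : ∑ x, (f x - f' x) = 0 := by
    rw [Finset.sum_congr rfl fun x _ => h1 x]
    have h3 : ((m : ZMod (m + 1)) + 1) = 0 := by exact_mod_cast ZMod.natCast_self (m + 1)
    rw [Finset.sum_const, Finset.card_univ, Fintype.card_fin, nsmul_eq_mul]
    push_cast
    rw [h3, zero_mul]
  rw [Finset.sum_sub_distrib] at h2
  exact sub_eq_zero.1 h2

/-- The invariant that is carried through the dimensions: the component of `w` of the parity of `k` has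
augmentation `1`; for `k = 0`, `w` is the norm element. -/
def NormalizedIn (k : ℕ) (w : Periodic m) : Prop :=
  if k = 0 then w = (fun _ => 1, fun _ => 0) else if Odd k then ∑ x, w.2 x = 1 else ∑ x, w.1 x = 1

theorem normalizedIn_succ {s : E → Fin (m + 1)} {g : E → E} (hs : ∀ x, s (g x) = s x + 1) {k : ℕ}
    {z z' : List E →₀ ZMod (m + 1)} (hz : NormalizedIn k (labelMap s z))
    (hz' : boundaryMap z' = periodicTheta m g k z) : NormalizedIn (k + 1) (labelMap s z') := by
  have h := periodicD_labelMap s z'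
  rw [hz'] at h
  rcases Nat.eq_zero_or_pos k with rfl | hk
  · rw [NormalizedIn, if_pos rfl] at hz
    rw [periodicTheta, if_pos rfl, Module.End.one_apply, hz] at h
    rw [NormalizedIn, if_neg (by omega), if_pos (by simp)]
    exact congrFun (congrArg Prod.fst h) 0
  · rw [NormalizedIn, if_neg hk.ne'] at hz
    rw [periodicTheta, if_neg hk.ne'] at h
    rw [NormalizedIn, if_neg (by omega)]
    rcases Nat.even_or_odd k with h' | h'
    · have h0 : ¬ Odd k := by simpa using h'
      rw [if_neg h0] at h hz
      rw [if_pos h'.add_one, ← hz]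
      rw [labelMap_geom_sum hs] at h
      exact congrFun (congrArg Prod.fst h) 0
    · have h0 : ¬ Odd (k + 1) := by simpa using h'.add_one
      rw [if_pos h'] at h hz
      rw [if_neg h0, ← hz]
      rw [LinearMap.sub_apply, map_sub, labelMap_mapMap hs] at h
      exact sum_eq_sum_of_sub_eq_sub fun x => congrFun (congrArg Prod.snd h) x

theorem NormalizedIn.ne_zero (hm : 0 < m) {k : ℕ} {w : Periodic m} (h : NormalizedIn k w) :
    w ≠ 0 := by
  have : Fact (1 < m + 1) := ⟨by omega⟩
  rintro rfl
  unfold NormalizedIn at h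
  split_ifs at h
  · exact zero_ne_one (congrFun (congrArg Prod.fst h) 0)
  · simp at h
  · simp at h

/-- A `ℤ/(m+1)`-version of Fan's lemma. Let `E` carry an action of the cyclic group and an invariant
filtration `S` such that `S k` can be coned off inside `S (k + 1)`. Then an equivariant labelling of
`E` has a chain of `n` elements on which consecutive labels differ. -/
theorem exists_alternating_chain [Preorder E] (hm : 0 < m) {g : E → E} (hg : Monotone g)
    (hgm : g^[m + 1] = id) {s : E → Fin (m + 1)} (hs : ∀ x, s (g x) = s x + 1) (n : ℕ)
    {S : ℕ → Set E} (hS : ∀ k, S k ⊆ S (k + 1)) (hgS : ∀ k, Set.MapsTo g (S k) (S k))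
    (hcone : ∀ k < n, ∃ e ∈ S (k + 1), ∃ j : E → E, MonotoneOn j (S k) ∧
      Set.MapsTo j (S k) (S (k + 1)) ∧ ∀ x ∈ S k, x ≤ j x ∧ e ≤ j x) :
    ∃ l : List E, l.length = n ∧ l.Pairwise (· ≤ ·) ∧ (∀ x ∈ l, x ∈ S n) ∧
      l.IsChain (s · ≠ s ·) := by
  -- build chains with `∂ z_{k + 1} = θ_k z_k`, as in the comparison of two free resolutions
  have key : ∀ k ≤ n, ∃ z ∈ orderChains (ZMod (m + 1)) (S k) k,
      boundaryMap (periodicTheta m g k z) = 0 ∧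
      periodicTheta m g (k + 1) (periodicTheta m g k z) = 0 ∧ NormalizedIn k (labelMap s z) := by
    intro k hk
    induction k with
    | zero =>
      refine ⟨Finsupp.single [] 1, Finsupp.single_mem_supported _ _ (by simp), ?_, ?_, ?_⟩
      · simp [periodicTheta, boundary]
      · simp [periodicTheta]
      · simp [NormalizedIn, comparison]
    | succ k ih =>
      obtain ⟨z, hz, hz1, hz2, hz3⟩ := ih (by omega)
      obtain ⟨e, he, j, hj, hjS, hle⟩ := hcone k (by omega)
      have hmem : ∀ i : ℕ, ∀ z ∈ orderChains (ZMod (m + 1)) (S k) k,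
          ((mapMap g) ^ i : Module.End _ _) z ∈ orderChains (ZMod (m + 1)) (S k) k := by
        intro i z hz
        induction i with
        | zero => simpa using hz
        | succ i ih =>
          rw [pow_succ', Module.End.mul_apply]
          exact mapMap_mem_orderChains (hg.monotoneOn _) (hgS k) ih
      have hθ : periodicTheta m g k z ∈ orderChains (ZMod (m + 1)) (S k) k := by
        unfold periodicTheta
        split_ifs
        · exact hz
        · exact Submodule.sub_mem _ (by simpa using hmem 1 z hz) hz
        · rw [LinearMap.sum_apply]
          exact Submodule.sum_mem _ fun i _ => hmem i z hz
      have hb := boundaryMap_coneMap e j hz1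
      refine ⟨_, coneMap_mem_orderChains (hS k) he hj hjS hle hθ, ?_, ?_,
        normalizedIn_succ hs hz3 hb⟩
      · have hcomm : ∀ w, boundaryMap (periodicTheta m g (k + 1) w) =
            periodicTheta m g (k + 1) (boundaryMap w) := by
          intro w
          have hpow : ∀ i : ℕ, boundaryMap (((mapMap g) ^ i : Module.End (ZMod (m + 1)) _) w) =
              ((mapMap g) ^ i : Module.End _ _) (boundaryMap w) := fun i => by
            rw [mapMap_pow, boundaryMap_mapMap]
          unfold periodicTheta
          rw [if_neg (by omega)]
          split_ifs
          · simp [boundaryMap_mapMap]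
          · simp [LinearMap.sum_apply, hpow]
        rw [hcomm, hb, hz2]
      · rw [← Module.End.mul_apply, periodicTheta_mul hgm (by omega), LinearMap.zero_apply]
  obtain ⟨z, hz, -, -, hz3⟩ := key n le_rfl
  by_contra hno
  push Not at hno
  refine hz3.ne_zero hm ?_
  have := map_mem_of_forall_mem_supported (N := ⊥) (labelMap s) (fun l hl => ?_) hz
  · simpa using this
  · obtain ⟨h1, h2, h3⟩ := hl
    simp only [labelMap_single, one_smul, Submodule.mem_bot]
    by_contra hl
    refine hno l h1 h2 h3 ?_
    simpa [List.isChain_map] using isChain_of_comparison_ne_zero _ hl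

end EquivariantLabelling

/-! ### Sign vectors -/

section SignVectors

variable {V A : Type*}

/-- Sign vectors with signs in `A`: partial functions from `V` to `A` that are defined somewhere
on `X`. -/
def SignVector (A : Type*) (X : Finset V) : Type _ :=
  {x : V → Option A // ∃ v ∈ X, x v ≠ none}

/-- `y` extends the partial function `x`. -/
def Extends (x y : V → Option A) : Prop :=
  ∀ v a, x v = some a → y v = some a

instance (X : Finset V) : Preorder (SignVector A X) where
  le x y := Extends x.1 y.1
  le_refl _ _ _ h := h
  le_trans _ _ _ h h' v a hv := h' v a (h v a hv)

/-- The cyclic action on the signs. -/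
def rotate [Add A] [One A] (x : V → Option A) : V → Option A :=
  fun v => (x v).map (· + 1)

def SignVector.rotate [Add A] [One A] {X : Finset V} (x : SignVector A X) : SignVector A X :=
  ⟨KneserType.rotate x.1, by
    obtain ⟨v, hv, h⟩ := x.2
    exact ⟨v, hv, by simpa [KneserType.rotate] using h⟩⟩

theorem extends_rotate [Add A] [One A] {x y : V → Option A} (h : Extends x y) :
    Extends (rotate x) (rotate y) := by
  intro v a hv
  simp only [rotate, Option.map_eq_some_iff] at hv ⊢
  obtain ⟨b, hb, rfl⟩ := hv
  exact ⟨b, h v b hb, rfl⟩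

/-- Fan's lemma for sign vectors: filter them by the initial segments of an enumeration of `X`, and cone
off along the vector with the single sign `0` at the next point. -/
theorem exists_alternating_chain_signVector {m : ℕ} (hm : 0 < m) (X : Finset V)
    {s : SignVector (Fin (m + 1)) X → Fin (m + 1)} (hs : ∀ x, s x.rotate = s x + 1) :
    ∃ l : List (SignVector (Fin (m + 1)) X), l.length = #X ∧ l.Pairwise (· ≤ ·) ∧
      l.IsChain (s · ≠ s ·) := by
  classical
  let S : ℕ → Set (SignVector (Fin (m + 1)) X) :=
    fun k => {x | ∀ a, x.1 a ≠ none → a ∈ X ∧ X.toList.idxOf a < k}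
  have hrot : (SignVector.rotate : SignVector (Fin (m + 1)) X → _)^[m + 1] = id := by
    have key : ∀ (i : ℕ) (x : SignVector (Fin (m + 1)) X) (v : V),
        (SignVector.rotate^[i] x).1 v = (x.1 v).map (· + Fin.ofNat (m + 1) i) := by
      intro i
      induction i with
      | zero => intro x v; simp
      | succ i ih =>
        intro x v
        rw [Function.iterate_succ_apply']
        change ((SignVector.rotate^[i] x).1 v).map (· + 1) = _
        rw [ih, Option.map_map]
        congr 1
        funext j
        rw [Function.comp_apply, add_assoc]
        congr 1
        ext
        simp [Fin.val_add]
    funext x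
    refine Subtype.ext (funext fun v => ?_)
    have h0 : Fin.ofNat (m + 1) (m + 1) = 0 := by ext; simp
    rw [key, h0]
    simp
  have hcone : ∀ k < #X, ∃ e ∈ S (k + 1), ∃ j : SignVector (Fin (m + 1)) X → _,
      MonotoneOn j (S k) ∧ Set.MapsTo j (S k) (S (k + 1)) ∧ ∀ x ∈ S k, x ≤ j x ∧ e ≤ j x := by
    intro k hk
    rw [← Finset.length_toList] at hk
    set v := X.toList[k] with hv
    have hvX : v ∈ X := Finset.mem_toList.1 (List.getElem_mem hk)
    have hvk : X.toList.idxOf v = k := X.nodup_toList.idxOf_getElem k hk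
    refine ⟨⟨Function.update (fun _ => none) v (some 0), v, hvX, by simp⟩, ?_,
      fun x => ⟨Function.update x.1 v (some 0), v, hvX, by simp⟩, ?_, ?_, ?_⟩
    · intro a ha
      by_cases h : a = v
      · subst h; exact ⟨hvX, by omega⟩
      · simp [h] at ha
    · intro x _ y _ hxy a b hab
      by_cases h : a = v
      · subst h; simpa using hab
      · simp only [Function.update_of_ne h] at hab ⊢
        exact hxy a b hab
    · intro x hx a ha
      by_cases h : a = v
      · subst h; exact ⟨hvX, by omega⟩
      · simp only [Function.update_of_ne h] at ha
        exact ⟨(hx a ha).1, (hx a ha).2.trans (Nat.lt_succ_self k)⟩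
    · refine fun x hx => ⟨fun a b hab => ?_, fun a b hab => ?_⟩
      · have h : a ≠ v := by
          rintro rfl
          have := (hx v (by simp [hab])).2
          omega
        simpa [h] using hab
      · by_cases h : a = v
        · subst h; simpa using hab
        · simp [h] at hab
  obtain ⟨l, h1, h2, -, h3⟩ := exists_alternating_chain hm (g := SignVector.rotate)
    (fun x y h => extends_rotate h) hrot hs #X (S := S)
    (fun k x hx a ha => ⟨(hx a ha).1, (hx a ha).2.trans (Nat.lt_succ_self k)⟩)
    (fun k x hx a ha => hx a (by simpa [SignVector.rotate, rotate] using ha)) hcone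
  exact ⟨l, h1, h2, h3⟩

/-- There is no equivariant labelling `s` together with a monotone rank `ρ` into `{1, …, D}` such that
`s` is constant on chains of constant rank, unless `D` is at least the number of points. -/
theorem card_le_of_rank {p : ℕ} (hp : 2 ≤ p) (X : Finset V)
    {s : SignVector (ZMod p) X → ZMod p} (hs : ∀ x, s x.rotate = s x + 1)
    {ρ : SignVector (ZMod p) X → ℕ} {D : ℕ} (hpos : ∀ x, 1 ≤ ρ x) (hD : ∀ x, ρ x ≤ D)
    (hmono : ∀ x y, x ≤ y → ρ x ≤ ρ y) (heq : ∀ x y, x ≤ y → ρ x = ρ y → s x = s y) :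
    #X ≤ D := by
  obtain ⟨l, h1, h2, h3⟩ : ∃ l : List (SignVector (ZMod p) X), l.length = #X ∧
      l.Pairwise (· ≤ ·) ∧ l.IsChain (s · ≠ s ·) := by
    match p, hp, s, hs with
    | m + 1, hp, s, hs => exact exists_alternating_chain_signVector (by omega) X hs
  have h4 : (l.map ρ).Pairwise (· < ·) := by
    rw [← List.isChain_iff_pairwise, List.isChain_map]
    rw [List.isChain_iff_getElem] at h3 ⊢
    intro i hi
    have hle := List.isChain_iff_getElem.1 h2.isChain i hi
    exact lt_of_le_of_ne (hmono _ _ hle) fun h' => h3 i hi (heq _ _ hle h')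
  have h5 : (l.map ρ).Nodup := h4.imp ne_of_lt
  have h6 : (l.map ρ).toFinset ⊆ Icc 1 D := by
    intro i hi
    simp only [List.mem_toFinset, List.mem_map] at hi
    obtain ⟨x, -, rfl⟩ := hi
    exact mem_Icc.2 ⟨hpos x, hD x⟩
  have h7 := Finset.card_le_card h6
  rw [List.toFinset_card_of_nodup h5] at h7
  simpa [h1] using h7

end SignVectors

/-! ### Means of sets of residues -/

section Mean

variable {p : ℕ} [Fact p.Prime]

/-- Translation by `1` of a set of residues. -/
def shift (T : Finset (ZMod p)) : Finset (ZMod p) :=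
  T.image (· + 1)

theorem filter_eq_shift {P P' : ZMod p → Prop} [DecidablePred P] [DecidablePred P']
    (h : ∀ j, P' (j + 1) ↔ P j) : univ.filter P' = shift (univ.filter P) := by
  ext j
  simp only [shift, mem_filter, mem_univ, true_and, mem_image]
  constructor
  · intro hj
    exact ⟨j - 1, (h _).1 (by simpa using hj), by simp⟩
  · rintro ⟨i, hi, rfl⟩
    exact (h i).2 hi

/-- Nonempty proper subsets of `ZMod p`, the ones on which translation acts freely for prime `p`. -/
def IsProper (T : Finset (ZMod p)) : Prop :=
  T.Nonempty ∧ T ≠ univ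

/-- The mean of a set of residues: an equivariant choice of a residue for every nonempty proper subset.
Its size is invertible modulo `p`. -/
def mean (T : Finset (ZMod p)) : ZMod p :=
  (∑ x ∈ T, x) / #T

theorem isProper_shift {T : Finset (ZMod p)} : IsProper (shift T) ↔ IsProper T := by
  have h : shift T = T.map (Equiv.addRight (1 : ZMod p)).toEmbedding := by
    ext; simp [shift]
  have h2 : univ.map (Equiv.addRight (1 : ZMod p)).toEmbedding = univ := by
    simp
  rw [IsProper, IsProper, h, Finset.map_nonempty, Ne, Ne]
  nth_rw 1 [← h2]
  rw [Finset.map_inj]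

theorem mean_shift {T : Finset (ZMod p)} (hT : IsProper T) : mean (shift T) = mean T + 1 := by
  have h0 : (#T : ZMod p) ≠ 0 := by
    rw [Ne, ZMod.natCast_eq_zero_iff]
    have h1 : #T < p := by
      have := (Finset.card_lt_iff_ne_univ T).2 hT.2
      rwa [ZMod.card] at this
    exact Nat.not_dvd_of_pos_of_lt hT.1.card_pos h1
  have hinj : Function.Injective (· + 1 : ZMod p → ZMod p) := add_left_injective 1
  rw [mean, mean, shift, Finset.card_image_of_injective _ hinj,
    Finset.sum_image hinj.injOn, Finset.sum_add_distrib]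
  field_simp
  simp

open Classical in
/-- The mean of the first nonempty proper subset in a list. -/
noncomputable def firstMean : List (Finset (ZMod p)) → ZMod p
  | [] => 0
  | T :: L => if IsProper T then mean T else firstMean L

theorem firstMean_map_shift {L : List (Finset (ZMod p))} (h : ∃ T ∈ L, IsProper T) :
    firstMean (L.map shift) = firstMean L + 1 := by
  induction L with
  | nil => simp at h
  | cons T L ih =>
    rw [List.map_cons, firstMean, firstMean]
    by_cases hT : IsProper T
    · rw [if_pos hT, if_pos (isProper_shift.2 hT), mean_shift hT]
    · rw [if_neg hT, if_neg (mt isProper_shift.1 hT)]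
      refine ih ?_
      obtain ⟨T', h1, h2⟩ := h
      rcases List.mem_cons.1 h1 with rfl | h1
      · exact absurd h2 hT
      · exact ⟨T', h1, h2⟩

theorem firstMean_append_congr {L M M' : List (Finset (ZMod p))}
    (h : (∀ T ∈ L, ¬ IsProper T) → firstMean M = firstMean M') :
    firstMean (L ++ M) = firstMean (L ++ M') := by
  induction L with
  | nil => exact h (by simp)
  | cons T L ih =>
    simp only [List.cons_append, firstMean]
    split_ifs with hT
    · rfl
    · exact ih fun hL => h (by simpa [hT] using hL)

end Mean

/-! ### Balanced sums -/

section Balanced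

variable {J : Type*} [Fintype J] [Nonempty J]

/-- The least value of `c`. -/
def minValue (c : J → ℕ) : ℕ := univ.inf' univ_nonempty c

/-- The largest sum of a function below `c` whose values differ by at most one. -/
def balancedSum (c : J → ℕ) : ℕ := ∑ j, min (c j) (minValue c + 1)

theorem minValue_le (c : J → ℕ) (j : J) : minValue c ≤ c j :=
  Finset.inf'_le _ (mem_univ j)

theorem exists_eq_minValue (c : J → ℕ) : ∃ j, c j = minValue c := by
  obtain ⟨j, -, hj⟩ := Finset.exists_mem_eq_inf' (univ_nonempty (α := J)) c
  exact ⟨j, hj.symm⟩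

theorem minValue_mono {c d : J → ℕ} (h : ∀ j, c j ≤ d j) : minValue c ≤ minValue d := by
  obtain ⟨j, hj⟩ := exists_eq_minValue d
  exact (minValue_le c j).trans ((h j).trans hj.le)

theorem balancedSum_mono {c d : J → ℕ} (h : ∀ j, c j ≤ d j) : balancedSum c ≤ balancedSum d :=
  Finset.sum_le_sum fun j _ => min_le_min (h j) (Nat.succ_le_succ (minValue_mono h))

theorem eq_of_balancedSum_eq {c d : J → ℕ} (h : ∀ j, c j ≤ d j)
    (hcd : balancedSum c = balancedSum d) :
    minValue c = minValue d ∧ ∀ j, minValue c < c j ↔ minValue d < d j := by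
  have h1 := (Finset.sum_eq_sum_iff_of_le fun j _ =>
    min_le_min (h j) (Nat.succ_le_succ (minValue_mono h))).1 hcd
  have h2 : minValue c = minValue d := by
    obtain ⟨j, hj⟩ := exists_eq_minValue c
    have := h1 j (mem_univ j)
    have := minValue_mono h
    have := minValue_le d j
    omega
  refine ⟨h2, fun j => ?_⟩
  have := h1 j (mem_univ j)
  omega

theorem balancedSum_pos {c : J → ℕ} {j : J} (hj : 0 < c j) : 0 < balancedSum c :=
  Finset.sum_pos' (fun _ _ => Nat.zero_le _) ⟨j, mem_univ j, by omega⟩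

end Balanced

/-- The sets `A j` are pairwise disjoint subsets of `X`, each of which meets every fibre of `π` at most
once. The fibres of `π` encode a partition of `X`. -/
def IsTransversalFamily {V J : Type*} (X : Finset V) (π : V → ℕ) (A : J → Finset V) : Prop :=
  (∀ j, A j ⊆ X) ∧ (∀ j, Set.InjOn π (A j)) ∧ ∀ i j, i ≠ j → Disjoint (A i) (A j)

/-! ### Uncoloured families for a prime number of sets -/

section PrimeCase

variable {V : Type*} {p t : ℕ} (X : Finset V) (π : V → ℕ)
  (C : Finset V → Fin t → Prop)

/-- The points of `X` to which `x` assigns the sign `j`. -/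
def cls (x : V → Option (ZMod p)) (j : ZMod p) : Finset V := X.filter (x · = some j)

/-- The fibres of `π` that the class of sign `j` meets. -/
def blocks (x : V → Option (ZMod p)) (j : ZMod p) : Finset ℕ := (cls X x j).image π

variable {X π}

theorem cls_rotate (x : V → Option (ZMod p)) (j : ZMod p) :
    cls X (rotate x) (j + 1) = cls X x j := by
  ext v
  simp [cls, rotate]

theorem blocks_rotate (x : V → Option (ZMod p)) (j : ZMod p) :
    blocks X π (rotate x) (j + 1) = blocks X π x j := by
  rw [blocks, cls_rotate, blocks]

theorem cls_mono {x y : V → Option (ZMod p)} (h : Extends x y) (j : ZMod p) :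
    cls X x j ⊆ cls X y j := by
  intro v
  simp only [cls, mem_filter]
  exact fun hv => ⟨hv.1, h v j hv.2⟩

theorem blocks_mono {x y : V → Option (ZMod p)} (h : Extends x y) (j : ZMod p) :
    blocks X π x j ⊆ blocks X π y j :=
  image_subset_image (cls_mono h j)

variable [Fact p.Prime] (X π)

open Classical in
/-- The signs whose class contains a transversal set of colour `k`. -/
noncomputable def colorSigns (x : V → Option (ZMod p)) (k : Fin t) : Finset (ZMod p) :=
  univ.filter fun j => ∃ A ⊆ cls X x j, Set.InjOn π A ∧ C A k

/-- The largest total size of an equitable family of transversal sets inside the classes of `x`. -/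
noncomputable def weight (x : V → Option (ZMod p)) : ℕ := balancedSum fun j => #(blocks X π x j)

/-- The signs whose class meets more than the least number of fibres. -/
noncomputable def topSigns (x : V → Option (ZMod p)) : Finset (ZMod p) :=
  univ.filter fun j => (minValue fun j => #(blocks X π x j)) < #(blocks X π x j)

/-- The sets of signs from which the label of a sign vector is computed, in order of priority. All of
them rotate with `x`, and the last ones are singletons, so a proper one occurs. -/
noncomputable def signSets (x : V → Option (ZMod p)) : List (Finset (ZMod p)) :=
  (List.finRange t).map (colorSigns X π C x) ++ ([topSigns X π x] ++
    (X.toList.map (fun v => univ.filter (π v ∈ blocks X π x ·)) ++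
      X.toList.map (fun v => univ.filter (x v = some ·))))

open Classical in
/-- The rank of a sign vector. Those without coloured sets in their classes come first, by weight; the
others are ranked above `α` by the number of signs that each colour occupies. -/
noncomputable def rank (α : ℕ) (x : V → Option (ZMod p)) : ℕ :=
  if ∃ k, (colorSigns X π C x k).Nonempty then α + ∑ k, #(colorSigns X π C x k) else weight X π x

variable {X π C}

open Classical in
theorem colorSigns_rotate (x : V → Option (ZMod p)) (k : Fin t) :
    colorSigns X π C (rotate x) k = shift (colorSigns X π C x k) :=
  filter_eq_shift fun j => by rw [cls_rotate]

theorem minValue_rotate (x : V → Option (ZMod p)) :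
    (minValue fun j => #(blocks X π (rotate x) j)) = minValue fun j => #(blocks X π x j) := by
  apply le_antisymm
  · obtain ⟨j, hj⟩ := exists_eq_minValue fun j => #(blocks X π x j)
    rw [← hj, ← blocks_rotate]
    exact minValue_le (fun j => #(blocks X π (rotate x) j)) (j + 1)
  · obtain ⟨j, hj⟩ := exists_eq_minValue fun j => #(blocks X π (rotate x) j)
    rw [← hj, ← sub_add_cancel j 1, blocks_rotate]
    exact minValue_le (fun j => #(blocks X π x j)) (j - 1)

theorem topSigns_rotate (x : V → Option (ZMod p)) :
    topSigns X π (rotate x) = shift (topSigns X π x) :=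
  filter_eq_shift fun j => by rw [minValue_rotate, blocks_rotate]

theorem signSets_rotate (x : V → Option (ZMod p)) :
    signSets X π C (rotate x) = (signSets X π C x).map shift := by
  simp only [signSets, List.map_append, List.map_map, List.map_cons, List.map_nil, topSigns_rotate]
  congr 2
  · exact funext fun k => colorSigns_rotate x k
  · congr 1
    · exact List.map_congr_left fun v _ => filter_eq_shift fun j => by rw [blocks_rotate]
    · exact List.map_congr_left fun v _ => filter_eq_shift fun j => by simp [rotate]

theorem firstMean_signSets_rotate {x : V → Option (ZMod p)} (hx : ∃ v ∈ X, x v ≠ none) :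
    firstMean (signSets X π C (rotate x)) = firstMean (signSets X π C x) + 1 := by
  rw [signSets_rotate]
  apply firstMean_map_shift
  obtain ⟨v, hv, h⟩ := hx
  obtain ⟨a, ha⟩ := Option.ne_none_iff_exists'.1 h
  refine ⟨univ.filter (x v = some ·), ?_, ⟨a, by simp [ha]⟩, fun h0 => ?_⟩
  · simp only [signSets, List.mem_append, List.mem_map, Finset.mem_toList]
    exact Or.inr (Or.inr (Or.inr ⟨v, hv, rfl⟩))
  · have h1 : a + 1 ∈ univ.filter (x v = some ·) := by rw [h0]; simp
    simp [ha] at h1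

theorem colorSigns_mono {x y : V → Option (ZMod p)} (h : Extends x y) (k : Fin t) :
    colorSigns X π C x k ⊆ colorSigns X π C y k := by
  intro j
  simp only [colorSigns, mem_filter, mem_univ, true_and]
  rintro ⟨A, hA, h'⟩
  exact ⟨A, hA.trans (cls_mono h j), h'⟩

theorem weight_mono {x y : V → Option (ZMod p)} (h : Extends x y) :
    weight X π x ≤ weight X π y :=
  balancedSum_mono fun j => Finset.card_le_card (blocks_mono h j)

theorem weight_pos {x : V → Option (ZMod p)} (hx : ∃ v ∈ X, x v ≠ none) :
    0 < weight X π x := by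
  obtain ⟨v, hv, h⟩ := hx
  obtain ⟨a, ha⟩ := Option.ne_none_iff_exists'.1 h
  refine balancedSum_pos (j := a) (Finset.card_pos.2 ⟨π v, ?_⟩)
  exact mem_image_of_mem _ (by simp [cls, hv, ha])

/-- If every fibre meets either no class of `x` or all `p` of them, then, as a fibre has at most `p`
points, `x` is defined on all points of the fibres it meets, so an extension with the same blocks
equals `x` on `X`. This is the place where parts of size `p` are allowed. -/
theorem eq_of_blocks_full (hπ : ∀ i, #(X.filter (π · = i)) ≤ p) {x y : V → Option (ZMod p)}
    (h : Extends x y) (hb : ∀ j, blocks X π x j = blocks X π y j)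
    (hfull : ∀ v ∈ X, ¬ IsProper (univ.filter (π v ∈ blocks X π x ·))) {v : V} (hv : v ∈ X) :
    x v = y v := by
  rcases hxv : x v with _ | a
  · rcases hyv : y v with _ | a
    · rfl
    exfalso
    have h1 : π v ∈ blocks X π x a := by
      rw [hb]
      exact mem_image_of_mem _ (by simp [cls, hv, hyv])
    have h2 : univ.filter (π v ∈ blocks X π x ·) = univ := by
      by_contra h2
      exact hfull v hv ⟨⟨a, by simpa using h1⟩, h2⟩
    -- the fibre of `v` would show all `p` signs and the undefined value
    have h3 : insert none (univ.image some) ⊆ (X.filter (π · = π v)).image x := by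
      intro o ho
      rcases mem_insert.1 ho with rfl | ho
      · exact mem_image.2 ⟨v, by simp [hv], hxv⟩
      · obtain ⟨j, -, rfl⟩ := mem_image.1 ho
        have hj : j ∈ univ.filter (π v ∈ blocks X π x ·) := by rw [h2]; simp
        obtain ⟨w, hw, hwv⟩ := mem_image.1 (mem_filter.1 hj).2
        obtain ⟨hw, hwj⟩ := mem_filter.1 hw
        exact mem_image.2 ⟨w, by simp [hw, hwv], hwj⟩
    have h4 := (Finset.card_le_card h3).trans (Finset.card_image_le.trans (hπ (π v)))
    rw [Finset.card_insert_of_notMem (by simp),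
      Finset.card_image_of_injective _ (Option.some_injective _), Finset.card_univ, ZMod.card] at h4
    omega
  · exact (h v a hxv).symm

theorem rank_mono {α : ℕ}
    (hα : ∀ x : V → Option (ZMod p), (∀ k, colorSigns X π C x k = ∅) → weight X π x ≤ α)
    {x y : V → Option (ZMod p)} (h : Extends x y) : rank X π C α x ≤ rank X π C α y := by
  have hmono := fun k => colorSigns_mono (X := X) (π := π) (C := C) h k
  unfold rank
  split_ifs with h1 h2 h2
  · exact Nat.add_le_add_left (Finset.sum_le_sum fun k _ => Finset.card_le_card (hmono k)) _
  · obtain ⟨k, hk⟩ := h1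
    exact absurd ⟨k, hk.mono (hmono k)⟩ h2
  · refine (hα x ?_).trans (Nat.le_add_right _ _)
    simpa [Finset.not_nonempty_iff_eq_empty] using h1
  · exact weight_mono h

theorem firstMean_eq_of_rank_eq (hπ : ∀ i, #(X.filter (π · = i)) ≤ p) {α : ℕ}
    (hα : ∀ x : V → Option (ZMod p), (∀ k, colorSigns X π C x k = ∅) → weight X π x ≤ α)
    (hne : ∀ (x : V → Option (ZMod p)) k, colorSigns X π C x k ≠ univ)
    {x y : V → Option (ZMod p)} (h : Extends x y) (hr : rank X π C α x = rank X π C α y) :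
    firstMean (signSets X π C x) = firstMean (signSets X π C y) := by
  have hmono := fun k => colorSigns_mono (X := X) (π := π) (C := C) h k
  have hcol : colorSigns X π C x = colorSigns X π C y := by
    unfold rank at hr
    split_ifs at hr with h1 h2 h2
    · have h3 := (Finset.sum_eq_sum_iff_of_le fun k _ => Finset.card_le_card (hmono k)).1
        (Nat.add_left_cancel hr)
      exact funext fun k => Finset.eq_of_subset_of_card_le (hmono k) (h3 k (mem_univ k)).ge
    · obtain ⟨k, hk⟩ := h1
      exact absurd ⟨k, hk.mono (hmono k)⟩ h2
    · have h3 := hα x (by simpa [Finset.not_nonempty_iff_eq_empty] using h1)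
      obtain ⟨k, hk⟩ := h2
      have h4 : #(colorSigns X π C y k) ≤ ∑ k, #(colorSigns X π C y k) :=
        Finset.single_le_sum (f := fun k => #(colorSigns X π C y k))
          (fun _ _ => Nat.zero_le _) (mem_univ k)
      have h5 := hk.card_pos
      omega
    · simp only [not_exists, Finset.not_nonempty_iff_eq_empty] at h1 h2
      exact funext fun k => (h1 k).trans (h2 k).symm
  rw [signSets, signSets, ← hcol]
  refine firstMean_append_congr fun hL => ?_
  have hL' : ¬ ∃ k, (colorSigns X π C x k).Nonempty := fun ⟨k, hk⟩ =>
    hL _ (List.mem_map_of_mem (List.mem_finRange k)) ⟨hk, hne x k⟩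
  have hw : weight X π x = weight X π y := by
    rw [rank, rank, ← hcol, if_neg hL', if_neg hL'] at hr
    exact hr
  obtain ⟨hmin, htop⟩ := eq_of_balancedSum_eq
    (fun j => Finset.card_le_card (blocks_mono (X := X) (π := π) h j)) hw
  have htop' : topSigns X π x = topSigns X π y := Finset.filter_congr fun j _ => htop j
  rw [← htop']
  refine firstMean_append_congr fun hT => ?_
  have hT' : topSigns X π x = ∅ := by
    by_contra h0
    refine hT _ (List.mem_singleton_self _) ⟨Finset.nonempty_iff_ne_empty.2 h0, fun h1 => ?_⟩
    obtain ⟨j, hj⟩ := exists_eq_minValue fun j => #(blocks X π x j)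
    have : j ∈ topSigns X π x := by rw [h1]; simp
    simp only [topSigns, mem_filter] at this
    omega
  have hb : ∀ j, blocks X π x j = blocks X π y j := by
    intro j
    refine Finset.eq_of_subset_of_card_le (blocks_mono h j) ?_
    have h1 : j ∉ topSigns X π y := by rw [← htop', hT']; simp
    simp only [topSigns, mem_filter, mem_univ, true_and, not_lt] at h1
    exact h1.trans (hmin.symm.le.trans (minValue_le (fun j => #(blocks X π x j)) j))
  simp only [← hb]
  refine firstMean_append_congr fun hS => ?_
  refine congrArg firstMean (List.map_congr_left fun v hv => ?_)
  rw [eq_of_blocks_full hπ h hb (fun w hw => hS _ (List.mem_map_of_mem (Finset.mem_toList.2 hw)))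
    (Finset.mem_toList.1 hv)]

/-- The case of a prime. Otherwise all sign vectors without coloured sets would have weight at most
`α = #X - 1 - t (p - 1)`, so `rank` would take values in `{1, …, #X - 1}`. -/
theorem exists_transversalFamily_zmod (hπ : ∀ i, #(X.filter (π · = i)) ≤ p)
    (hC : ∀ (k : Fin t) (A : ZMod p → Finset V), IsTransversalFamily X π A → ∃ j, ¬ C (A j) k) :
    ∃ A : ZMod p → Finset V, IsTransversalFamily X π A ∧ (∀ j k, ¬ C (A j) k) ∧
      (∀ i j, #(A i) ≤ #(A j) + 1) ∧ #X ≤ ∑ j, #(A j) + t * (p - 1) := by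
  by_cases hX : #X ≤ t * (p - 1)
  · have h0 : IsTransversalFamily X π (fun _ : ZMod p => (∅ : Finset V)) := by
      refine ⟨?_, ?_, ?_⟩ <;> simp
    refine ⟨_, h0, fun j k hk => ?_, by simp, by simpa using hX⟩
    obtain ⟨j, hj⟩ := hC k _ h0
    exact hj hk
  have hdisj : ∀ (x : V → Option (ZMod p)) (A : ZMod p → Finset V), (∀ j, A j ⊆ cls X x j) →
      (∀ j, Set.InjOn π (A j)) → IsTransversalFamily X π A := by
    refine fun x A hA hinj => ⟨fun j => (hA j).trans (filter_subset _ _), hinj, fun i j hij => ?_⟩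
    refine Finset.disjoint_left.2 fun v hi hj => hij ?_
    have h1 := (mem_filter.1 (hA i hi)).2
    have h2 := (mem_filter.1 (hA j hj)).2
    exact Option.some_injective _ (h1.symm.trans h2)
  -- a colour on all signs would be shared by `p` disjoint transversal sets
  have hne : ∀ (x : V → Option (ZMod p)) k, colorSigns X π C x k ≠ univ := by
    intro x k h
    have h1 : ∀ j, ∃ A ⊆ cls X x j, Set.InjOn π A ∧ C A k := fun j => by
      have : j ∈ colorSigns X π C x k := by rw [h]; simp
      simpa [colorSigns] using this
    choose A hA hA1 hA2 using h1
    obtain ⟨j, hj⟩ := hC k A (hdisj x A hA hA1)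
    exact hj (hA2 j)
  by_contra hno
  set α := #X - 1 - t * (p - 1) with hαdef
  -- otherwise transversals of the classes, cut down to balanced sizes, are the family wanted
  have hα : ∀ x : V → Option (ZMod p), (∀ k, colorSigns X π C x k = ∅) → weight X π x ≤ α := by
    intro x hx
    by_contra hlt
    apply hno
    have h1 : ∀ j, ∃ A ⊆ cls X x j, Set.InjOn π A ∧
        #A = min #(blocks X π x j) ((minValue fun j => #(blocks X π x j)) + 1) := by
      intro j
      obtain ⟨u, hu, hinj, himg⟩ := Finset.exists_subset_injOn_image_eq_of_surjOn
        (cls X x j : Set V) (blocks X π x j) (f := π) (by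
          rw [blocks, Finset.coe_image]; exact Set.surjOn_image _ _)
      have hcard : #u = #(blocks X π x j) := by
        rw [← himg, Finset.card_image_of_injOn hinj]
      obtain ⟨A, hA, hA'⟩ := Finset.exists_subset_card_eq
        (min_le_left #(blocks X π x j) ((minValue fun j => #(blocks X π x j)) + 1) |>.trans
          hcard.ge)
      exact ⟨A, hA.trans (by exact_mod_cast hu), hinj.mono (by exact_mod_cast hA), hA'⟩
    choose A hA hA1 hA2 using h1
    refine ⟨A, hdisj x A hA hA1, fun j k hk => ?_, fun i j => ?_, ?_⟩
    · have : j ∈ colorSigns X π C x k := by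
        simp only [colorSigns, mem_filter, mem_univ, true_and]
        exact ⟨A j, hA j, hA1 j, hk⟩
      simp [hx k] at this
    · rw [hA2, hA2]
      have : (minValue fun j => #(blocks X π x j)) ≤ #(blocks X π x j) := minValue_le _ j
      omega
    · have : ∑ j, #(A j) = weight X π x := Finset.sum_congr rfl fun j _ => hA2 j
      omega
  have hp := (Fact.out : p.Prime).two_le
  have hcard : ∀ (x : V → Option (ZMod p)) k, #(colorSigns X π C x k) ≤ p - 1 := by
    intro x k
    have := (Finset.card_lt_iff_ne_univ _).2 (hne x k)
    rw [ZMod.card] at this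
    omega
  have hfinal := card_le_of_rank hp X
    (s := fun x => firstMean (signSets X π C x.1)) (ρ := fun x => rank X π C α x.1)
    (D := α + t * (p - 1)) (fun x => firstMean_signSets_rotate x.2) ?_ ?_
    (fun x y h => rank_mono hα h) (fun x y h => firstMean_eq_of_rank_eq hπ hα hne h)
  · omega
  · intro x
    simp only [rank]
    split_ifs with h
    · obtain ⟨k, hk⟩ := h
      have h4 : #(colorSigns X π C x.1 k) ≤ ∑ k, #(colorSigns X π C x.1 k) :=
        Finset.single_le_sum (f := fun k => #(colorSigns X π C x.1 k))
          (fun _ _ => Nat.zero_le _) (mem_univ k)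
      have h5 := hk.card_pos
      omega
    · exact weight_pos x.2
  · intro x
    simp only [rank]
    split_ifs with h
    · have := Finset.sum_le_card_nsmul univ (fun k => #(colorSigns X π C x.1 k)) (p - 1)
        fun k _ => hcard _ k
      simp only [Finset.card_univ, Fintype.card_fin, smul_eq_mul] at this
      omega
    · refine (hα _ ?_).trans (Nat.le_add_right _ _)
      simpa [Finset.not_nonempty_iff_eq_empty] using h

end PrimeCase

/-! ### From primes to all numbers of sets -/

/-- The partition and colouring statement for `r` sets. A colouring is any relation `C` between sets and
`t` colours, such that no colour is shared by `r` disjoint transversal sets. Then there are `r`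
disjoint transversal sets of nearly equal sizes without colours that miss at most `t (r - 1)`
points. -/
def HasUncoloredFamilies (V : Type*) (r : ℕ) : Prop :=
  ∀ (X : Finset V) (π : V → ℕ) (_ : ∀ i, #(X.filter (π · = i)) ≤ r) (t : ℕ)
    (C : Finset V → Fin t → Prop)
    (_ : ∀ (k : Fin t) (A : Fin r → Finset V), IsTransversalFamily X π A → ∃ j, ¬ C (A j) k),
    ∃ A : Fin r → Finset V, IsTransversalFamily X π A ∧ (∀ j k, ¬ C (A j) k) ∧
      (∀ i j, #(A i) ≤ #(A j) + 1) ∧ #X ≤ ∑ j, #(A j) + t * (r - 1)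

variable {V : Type*}

theorem IsTransversalFamily.comp {J J' : Type*} {X : Finset V} {π : V → ℕ} {A : J → Finset V}
    (h : IsTransversalFamily X π A) {e : J' → J} (he : Function.Injective e) :
    IsTransversalFamily X π (A ∘ e) :=
  ⟨fun _ => h.1 _, fun _ => h.2.1 _, fun _ _ hij => h.2.2 _ _ (he.ne hij)⟩

theorem hasUncoloredFamilies_prime {p : ℕ} (hp : p.Prime) : HasUncoloredFamilies V p := by
  have : Fact p.Prime := ⟨hp⟩
  intro X π hπ t C hC
  have e : Fin p ≃ ZMod p := Fintype.equivOfCardEq (by simp [ZMod.card])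
  obtain ⟨A, hA, h1, h2, h3⟩ := exists_transversalFamily_zmod (C := C) hπ fun k A hA => by
    obtain ⟨j, hj⟩ := hC k (A ∘ e) (hA.comp e.injective)
    exact ⟨e j, hj⟩
  refine ⟨A ∘ e, hA.comp e.injective, fun j k => h1 _ k, fun i j => h2 _ _, ?_⟩
  rwa [← e.sum_comp] at h3

theorem hasUncoloredFamilies_one : HasUncoloredFamilies V 1 := by
  intro X π hπ t C hC
  have h0 : IsTransversalFamily X π (fun _ : Fin 1 => X) := by
    refine ⟨fun _ => Subset.rfl, fun _ v hv w hw hvw => ?_,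
      fun i j hij => absurd (Subsingleton.elim i j) hij⟩
    exact Finset.card_le_one.1 (hπ (π w)) v (by simpa [hvw] using hv) w (by simpa using hw)
  refine ⟨_, h0, fun j k hk => ?_, by simp, by simp⟩
  obtain ⟨j, hj⟩ := hC k _ h0
  exact hj hk

/-- A function with nearly equal values can be lowered to any smaller sum: lower a maximal value. -/
theorem exists_equitable_le {J : Type*} [Fintype J] {N : ℕ} {a : J → ℕ}
    (ha : ∀ i j, a i ≤ a j + 1) (hN : N ≤ ∑ j, a j) :
    ∃ b : J → ℕ, (∀ j, b j ≤ a j) ∧ (∀ i j, b i ≤ b j + 1) ∧ ∑ j, b j = N := by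
  classical
  obtain ⟨d, hd⟩ := Nat.exists_eq_add_of_le hN
  clear hN
  induction d generalizing a with
  | zero => exact ⟨a, fun _ => le_rfl, ha, hd⟩
  | succ d ih =>
    have hJ : (univ : Finset J).Nonempty := by
      by_contra h
      rw [Finset.not_nonempty_iff_eq_empty] at h
      rw [h, Finset.sum_empty] at hd
      omega
    obtain ⟨i, -, hi⟩ := Finset.exists_max_image univ a hJ
    have hpos : 0 < a i := by
      by_contra h
      have : ∑ j, a j = 0 := Finset.sum_eq_zero fun j hj => by have := hi j hj; omega
      omega
    have hupd : ∀ j, Function.update a i (a i - 1) j ≤ a j := by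
      intro j
      by_cases h : j = i
      · subst h; simp
      · simp [h]
    have heq : ∀ j k, Function.update a i (a i - 1) j ≤ Function.update a i (a i - 1) k + 1 := by
      intro j k
      by_cases hk : k = i
      · subst hk
        have := hi j (mem_univ j)
        have := hupd j
        rw [Function.update_self]
        omega
      · rw [Function.update_of_ne hk]
        exact (hupd j).trans (ha j k)
    have hsum : ∑ j, Function.update a i (a i - 1) j = N + d := by
      rw [Finset.sum_update_of_mem (mem_univ i)]
      have := Finset.add_sum_erase univ a (mem_univ i)
      rw [Finset.sdiff_singleton_eq_erase]
      omega
    obtain ⟨b, h1, h2, h3⟩ := ih heq hsum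
    exact ⟨b, fun j => (h1 j).trans (hupd j), h2, h3⟩

/-- Fibres of size at most `a * b` are split into at most `a` pieces of size at most `b`. -/
theorem exists_refined_labelling (X : Finset V) (π : V → ℕ) {a b : ℕ}
    (hπ : ∀ i, #(X.filter (π · = i)) ≤ a * b) :
    ∃ π' : V → ℕ, (∀ i, #(X.filter (π' · = i)) ≤ b) ∧
      ∀ B ⊆ X, Set.InjOn π' B → ∀ i, #(B.filter (π · = i)) ≤ a := by
  classical
  have h1 : ∀ i, ∃ f : V → ℕ, Set.InjOn f (X.filter (π · = i)) ∧
      ∀ v ∈ X.filter (π · = i), f v < a * b := by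
    intro i
    refine ⟨fun v => (X.filter (π · = i)).toList.idxOf v, fun v hv w _ hvw => ?_, fun v hv => ?_⟩
    · exact (List.idxOf_inj (Finset.mem_toList.2 hv)).1 hvw
    · refine lt_of_lt_of_le (List.idxOf_lt_length_of_mem (Finset.mem_toList.2 hv)) ?_
      rw [Finset.length_toList]
      exact hπ i
  choose f hf hfb using h1
  have hself : ∀ v ∈ X, v ∈ X.filter (π · = π v) := fun v hv => by simp [hv]
  refine ⟨fun v => Nat.pair (π v) (f (π v) v / b), fun n => ?_, fun B hB hinj i => ?_⟩
  · set i := n.unpair.1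
    set c := n.unpair.2
    have key : ∀ v ∈ X.filter (fun v => Nat.pair (π v) (f (π v) v / b) = n),
        v ∈ X.filter (π · = i) ∧ f i v / b = c := by
      intro v hv
      obtain ⟨hvX, hvn⟩ := mem_filter.1 hv
      have h2 : n.unpair = (π v, f (π v) v / b) := by rw [← hvn, Nat.unpair_pair]
      rw [show i = π v from congrArg Prod.fst h2,
        show c = f (π v) v / b from congrArg Prod.snd h2]
      exact ⟨hself v hvX, rfl⟩
    calc #(X.filter (fun v => Nat.pair (π v) (f (π v) v / b) = n))
        ≤ #(Ico (c * b) (c * b + b)) := by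
          refine Finset.card_le_card_of_injOn (f i) (fun v hv => ?_) fun v hv w hw hvw => ?_
          · obtain ⟨h1, h2⟩ := key v hv
            have hb : 0 < b := Nat.pos_of_ne_zero fun h0 => by
              have := hfb i v h1
              simp [h0] at this
            have h3 := Nat.div_add_mod (f i v) b
            have h4 := Nat.mod_lt (f i v) hb
            rw [h2, mul_comm] at h3
            simp only [coe_Ico, Set.mem_Ico]
            omega
          · exact hf i (key v hv).1 (key w hw).1 hvw
      _ = b := by simp
  · calc #(B.filter (π · = i)) ≤ #(range a) := by
          refine Finset.card_le_card_of_injOn (fun v => f i v / b) (fun v hv => ?_)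
            fun v hv w hw hvw => ?_
          · obtain ⟨hvB, rfl⟩ := mem_filter.1 hv
            have := hfb _ v (hself v (hB hvB))
            simp only [coe_range, Set.mem_Iio]
            exact Nat.div_lt_of_lt_mul (by rwa [mul_comm] at this)
          · obtain ⟨hvB, hv'⟩ := mem_filter.1 hv
            obtain ⟨hwB, hw'⟩ := mem_filter.1 hw
            refine hinj hvB hwB ?_
            simp only at hvw ⊢
            rw [hv', hw', hvw]
      _ = a := card_range a

theorem equitable_of_equitable_sums {I J : Type*} [Fintype J] {a : I → J → ℕ}
    (h : ∀ i j j', a i j ≤ a i j' + 1) (hsum : ∀ i i', ∑ j, a i j ≤ ∑ j, a i' j + 1)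
    (i i' : I) (j j' : J) : a i j ≤ a i' j' + 1 := by
  by_contra hlt
  have h1 : ∑ k, (a i' j' + 1) < ∑ k, a i k :=
    Finset.sum_lt_sum (fun k _ => by have := h i j k; omega) ⟨j, mem_univ j, by omega⟩
  have h2 : ∑ k, a i' k < ∑ k : J, (a i' j' + 1) :=
    Finset.sum_lt_sum (fun k _ => h i' k j') ⟨j', mem_univ j', by omega⟩
  have := hsum i i'
  omega

/-- The product step. A set gets the colour `k` if it contains `a` disjoint transversal sets of colour
`k`; apply the statement for `b` to this colouring and the one for `a` inside each of the
resulting sets. -/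
theorem HasUncoloredFamilies.mul {a b : ℕ} (ha : 0 < a) (hb : 0 < b)
    (hVa : HasUncoloredFamilies V a) (hVb : HasUncoloredFamilies V b) :
    HasUncoloredFamilies V (a * b) := by
  intro X π hπ t C₀ hC₀
  -- closing the colours upwards makes it possible to shrink uncoloured sets
  let C : Finset V → Fin t → Prop := fun B k => ∃ A ⊆ B, C₀ A k
  have hC : ∀ (k : Fin t) (A : Fin a × Fin b → Finset V), IsTransversalFamily X π A →
      ∃ j, ¬ C (A j) k := by
    intro k A hA
    by_contra hno
    push Not at hno
    choose B hB hB' using hno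
    let e : Fin (a * b) ≃ Fin a × Fin b := finProdFinEquiv.symm
    obtain ⟨j, hj⟩ := hC₀ k (B ∘ e) ⟨fun j => (hB _).trans (hA.1 _),
      fun j => (hA.2.1 (e j)).mono (by exact_mod_cast hB (e j)),
      fun i j hij => (hA.2.2 _ _ (e.injective.ne hij)).mono (hB _) (hB _)⟩
    exact hj (hB' _)
  obtain ⟨π', hπ', hfib⟩ := exists_refined_labelling X π hπ
  obtain ⟨B, hB, hBC, hBeq, hBsum⟩ := hVb X π' hπ' t
    (fun B k => ∃ A : Fin a → Finset V, IsTransversalFamily B π A ∧ ∀ j, C (A j) k) (by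
      intro k B hB
      by_contra hno
      push Not at hno
      choose A hA hAC using hno
      obtain ⟨⟨j, i⟩, hji⟩ := hC k (fun q => A q.2 q.1)
        ⟨fun q => ((hA q.2).1 q.1).trans (hB.1 q.2), fun q => (hA q.2).2.1 q.1, by
          rintro ⟨j, i⟩ ⟨j', i'⟩ hne
          by_cases hi : i = i'
          · subst hi
            exact (hA i).2.2 j j' fun hj => hne (by rw [hj])
          · exact (hB.2.2 i i' hi).mono ((hA i).1 j) ((hA i').1 j')⟩
      exact hji (hAC i j))
  have hinner : ∀ i, ∃ A : Fin a → Finset V, IsTransversalFamily (B i) π A ∧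
      (∀ j k, ¬ C₀ (A j) k) ∧ (∀ j j', #(A j) ≤ #(A j') + 1) ∧
      ∑ j, #(A j) = #(B i) - t * (a - 1) := by
    intro i
    obtain ⟨A, hA, hAC, hAeq, hAsum⟩ := hVa (B i) π (hfib (B i) (hB.1 i) (hB.2.1 i)) t C (by
      intro k A hA
      by_contra hno
      push Not at hno
      exact hBC i k ⟨A, hA, hno⟩)
    obtain ⟨c, hc1, hc2, hc3⟩ := exists_equitable_le (N := #(B i) - t * (a - 1)) hAeq (by omega)
    choose A' hA' hcard using fun j => Finset.exists_subset_card_eq (hc1 j)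
    refine ⟨A', ⟨fun j => (hA' j).trans (hA.1 j),
      fun j => (hA.2.1 j).mono (by exact_mod_cast hA' j),
      fun j j' hj => (hA.2.2 j j' hj).mono (hA' j) (hA' j')⟩,
      fun j k hk => hAC j k ⟨A' j, hA' j, hk⟩, fun j j' => by simpa only [hcard] using hc2 j j',
      by simpa only [hcard] using hc3⟩
  choose A hA hAC hAeq hAsum using hinner
  let e : Fin (a * b) ≃ Fin a × Fin b := finProdFinEquiv.symm
  refine ⟨fun q => A (e q).2 (e q).1, ⟨fun q => ((hA _).1 _).trans (hB.1 _),
    fun q => (hA _).2.1 _, fun q q' hq => ?_⟩, fun q k => hAC _ _ k, fun q q' => ?_, ?_⟩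
  · by_cases hi : (e q).2 = (e q').2
    · change Disjoint (A (e q).2 (e q).1) (A (e q').2 (e q').1)
      rw [← hi]
      exact (hA _).2.2 _ _ fun hj => hq (e.injective (Prod.ext hj hi))
    · exact (hB.2.2 _ _ hi).mono ((hA _).1 _) ((hA _).1 _)
  · refine equitable_of_equitable_sums (a := fun i j => #(A i j)) hAeq (fun i i' => ?_) _ _ _ _
    rw [hAsum, hAsum]
    have := hBeq i i'
    omega
  · have h1 : ∑ q, #(A (e q).2 (e q).1) = ∑ i, (#(B i) - t * (a - 1)) := by
      rw [e.sum_comp (fun q : Fin a × Fin b => #(A q.2 q.1)), Fintype.sum_prod_type_right]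
      exact Finset.sum_congr rfl fun i _ => hAsum i
    have h2 : ∑ i, #(B i) ≤ ∑ i : Fin b, (#(B i) - t * (a - 1)) + b * (t * (a - 1)) := by
      calc ∑ i, #(B i) ≤ ∑ i : Fin b, ((#(B i) - t * (a - 1)) + t * (a - 1)) :=
            Finset.sum_le_sum fun i _ => by omega
        _ = _ := by simp [Finset.sum_add_distrib]
    have h3 : b * (t * (a - 1)) + t * (b - 1) = t * (a * b - 1) := by
      obtain ⟨a, rfl⟩ := Nat.exists_eq_succ_of_ne_zero ha.ne'
      obtain ⟨b, rfl⟩ := Nat.exists_eq_succ_of_ne_zero hb.ne'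
      have : (a + 1) * (b + 1) - 1 = a * b + a + b := by
        rw [show (a + 1) * (b + 1) = a * b + a + b + 1 by ring, Nat.add_sub_cancel]
      simp only [Nat.succ_eq_add_one, Nat.add_sub_cancel, this]
      ring
    rw [h1]
    omega

theorem hasUncoloredFamilies {r : ℕ} (hr : 0 < r) : HasUncoloredFamilies V r := by
  induction r using induction_on_primes with
  | zero => omega
  | one => exact hasUncoloredFamilies_one
  | prime_mul p a hp ih =>
    have ha : 0 < a := Nat.pos_of_mul_pos_left hr
    exact (hasUncoloredFamilies_prime hp).mul hp.pos ha (ih ha)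

/-! ### Kneser hypergraphs -/

section Kneser

variable {α ι : Type*} [DecidableEq α]

theorem Admissible.of_injOn {P : ι → Finset α} {π : α → ℕ}
    (hπ : ∀ i, ∀ v ∈ P i, ∀ w ∈ P i, π v = π w) {A : Finset α} (hA : Set.InjOn π A) :
    Admissible P A := by
  intro i
  rw [Finset.card_le_one]
  intro v hv w hw
  rw [mem_inter] at hv hw
  exact hA hv.1 hw.1 (hπ i v hv.2 w hw.2)

theorem card_inter_le_of_subsetUpTo {s : ℕ} {F F' A A' : Finset α}
    (hF : SubsetUpTo (s / 2) F A) (hF' : SubsetUpTo (s / 2) F' A') (hA : Disjoint A A') :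
    #(F ∩ F') ≤ s := by
  obtain ⟨E, hE, hEA⟩ := hF
  obtain ⟨E', hE', hEA'⟩ := hF'
  -- outside the two exceptional sets the members lie in disjoint sets
  have h : F ∩ F' ⊆ E ∪ E' := by
    intro v hv
    rw [mem_inter] at hv
    by_contra hno
    rw [mem_union, not_or] at hno
    exact Finset.disjoint_left.1 hA (hEA (mem_sdiff.2 ⟨hv.1, hno.1⟩))
      (hEA' (mem_sdiff.2 ⟨hv.2, hno.2⟩))
  have h1 := (Finset.card_le_card h).trans (Finset.card_union_le _ _)
  omega

/-- A set gets the colour of each vertex `F` of the hypergraph with `F ⊆_{s / 2} A`. As two such vertices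
over disjoint sets share at most `2 (s / 2) ≤ s` points, a colour on `r` disjoint sets yields a
monochromatic edge. Goodness says that uncoloured admissible sets contain no member of `𝓕`
up to `s / 2` points. -/
theorem ecd_le_of_colorable [Fintype α] {r s t l : ℕ} (hr : 0 < r) {P : Fin l → Finset α}
    (hP : IsPartitionOf P Finset.univ) (hPr : ∀ i, #(P i) ≤ r) {𝓕 : Set (Finset α)}
    (h𝓕 : ∀ F ∈ 𝓕, s < #F) (hgood : Good 𝓕 P (s / 2)) (ht : Colorable (KG r 𝓕 P s) t) :
    ecd r 𝓕 (s / 2) ≤ t * (r - 1) := by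
  obtain ⟨c, hc⟩ := ht
  have hex : ∀ v, ∃ i, v ∈ P i := fun v => by
    have : v ∈ Finset.univ.biUnion P := by rw [hP.2]; simp
    simpa using this
  choose part hpart using hex
  have huniq : ∀ i, ∀ v ∈ P i, part v = i := by
    intro i v hv
    by_contra h
    exact Finset.disjoint_left.1 (hP.1 _ _ h) (hpart v) hv
  have hadm : ∀ A : Finset α, Set.InjOn (fun v => (part v : ℕ)) A → Admissible P A :=
    fun A hA => Admissible.of_injOn (fun i v hv w hw => by
      simp only [huniq i v hv, huniq i w hw]) hA
  let C : Finset α → Fin t → Prop := fun A k =>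
    ∃ F : (KG r 𝓕 P s).vertexSet, c F = k ∧ SubsetUpTo (s / 2) F A
  have hfib : ∀ n, #(univ.filter fun v => (part v : ℕ) = n) ≤ r := by
    intro n
    by_cases hn : n < l
    · refine (Finset.card_le_card fun v hv => ?_).trans (hPr ⟨n, hn⟩)
      have h : part v = ⟨n, hn⟩ := Fin.ext (mem_filter.1 hv).2
      rw [← h]
      exact hpart v
    · rw [Finset.filter_false_of_mem fun v _ (h : (part v : ℕ) = n) => hn (h ▸ (part v).2)]
      simp
  have hcol : ∀ (k : Fin t) (A : Fin r → Finset α),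
      IsTransversalFamily univ (fun v => (part v : ℕ)) A → ∃ j, ¬ C (A j) k := by
    intro k A hA
    by_contra hno
    push Not at hno
    choose F hFk hFA using hno
    have hinter : ∀ i j, i ≠ j → #((F i : Finset α) ∩ F j) ≤ s := fun i j hij =>
      card_inter_le_of_subsetUpTo (hFA i) (hFA j) (hA.2.2 i j hij)
    have hinj : Function.Injective fun j => (F j : Finset α) := by
      intro i j hij
      by_contra hne
      have h1 := hinter i j hne
      have h2 := h𝓕 _ (F i).2.1
      simp only at hij
      rw [← hij, inter_self] at h1
      omega
    obtain ⟨x, y, ⟨i, hi⟩, ⟨j, hj⟩, hxy⟩ := hc (Set.range fun j => (F j : Finset α)) ⟨by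
        rintro _ ⟨j, rfl⟩
        exact (F j).2, by
        rw [Set.ncard_range_of_injective hinj, Nat.card_fin], by
        rintro _ ⟨i, rfl⟩ _ ⟨j, rfl⟩ hne
        exact hinter i j fun h => hne (by rw [h])⟩
    refine hxy ?_
    rw [← Subtype.ext hi, ← Subtype.ext hj, hFk, hFk]
  obtain ⟨A, hA, hAC, hAeq, hAsum⟩ := hasUncoloredFamilies hr (univ : Finset α)
    (fun v => (part v : ℕ)) hfib t C hcol
  have hbad : ∀ F ∈ 𝓕, ∀ j, ¬ SubsetUpTo (s / 2) F (A j) := by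
    intro F hF j hFA
    obtain ⟨F', h1, h2, h3⟩ := hgood (A j) (hadm _ (hA.2.1 j)) ⟨F, hF, hFA⟩
    exact hAC j _ ⟨⟨F', h1, h2⟩, rfl, h3⟩
  have hcard := Finset.card_biUnion (s := univ) (t := A) fun i _ j _ hij => hA.2.2 i j hij
  have hle := Finset.card_le_univ (univ.biUnion A)
  calc ecd r 𝓕 (s / 2) ≤ #(univ \ univ.biUnion A) := by
        refine Nat.sInf_le ⟨_, rfl, A, ⟨⟨hA.2.2, by simp⟩, hAeq⟩, hbad⟩
    _ ≤ t * (r - 1) := by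
        rw [Finset.card_sdiff_of_subset (subset_univ _), hcard]
        omega

end Kneser

end KneserType

theorem theorem5 (n r s l : ℕ) (hn : 1 ≤ n) (hr : 2 ≤ r)
    (P : Fin l → Finset (Fin n)) (hP : KneserType.IsPartitionOf P Finset.univ)
    (hPr : ∀ i, (P i).card ≤ r)
    (𝓕 : Set (Finset (Fin n))) (h𝓕 : ∀ F ∈ 𝓕, s < F.card)
    (hgood : KneserType.Good 𝓕 P (s / 2)) :
    ((⌈(KneserType.ecd r 𝓕 (s / 2) : ℚ) / ((r : ℚ) - 1)⌉₊ : ℕ) : ℕ∞) ≤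
      KneserType.chromaticNumber (KneserType.KG r 𝓕 P s) := by
  refine le_iInf₂ fun t ht => ?_
  have h := KneserType.ecd_le_of_colorable (by omega) hP hPr h𝓕 hgood ht
  rw [Nat.cast_le, Nat.ceil_le]
  have hr' : (0 : ℚ) < (r : ℚ) - 1 := by
    have : (2 : ℚ) ≤ r := by exact_mod_cast hr
    linarith
  rw [div_le_iff₀ hr']
  have h2 : ((KneserType.ecd r 𝓕 (s / 2) : ℕ) : ℚ) ≤ ((t * (r - 1) : ℕ) : ℚ) := by
    exact_mod_cast h
  rwa [Nat.cast_mul, Nat.cast_sub (by omega), Nat.cast_one] at h2
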